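/- Let $\mathbb{D}=\{z\in\mathbb{C}:|z|<1\}$ and $1<p<\infty$. The analytic Besov space $B^p$ consists of all analytic functions $f$ in $\mathbb{D}$ with $$\|f\|_{B^p}=\Big(|f(0)|^p+\int_{\mathbb{D}}(1-|z|^2)^{p-2}|f'(z)|^p\,dA(z)\Big)^{1/p}<\infty ,$$ where $dA$ is area measure. For a positive Borel measure $\mu$ on $[0,1)$ with finite moments $\mu_n=\int_{[0,1)}t^n\,d\mu(t)$, $n\ge 0$, and $f(z)=\sum_{k\ge 0}a_kz^k$ analytic in $\mathbb{D}$, put $$\mathcal{H}_\mu(f)(z)=\sum_{n=0}^\infty\Big(\sum_{k=0}^\infty \mu_{n+k}a_k\Big)z^n$$ whenever the right-hand side makes sense (all the series converge for every $z\in\mathbb{D}$) and so defines an analytic function in $\mathbb{D}$. We say that $\mathcal{H}_\mu$ is bounded from $B^p$ into itself if the moments $\mu_n$ are finite, $\mathcal{H}_\mu(f)$ is well defined and belongs to $B^p$ for every $f\in B^p$, and there is a constant $C$ with $\|\mathcal{H}_\mu(f)\|_{B^p}\le C\|f\|_{B^p}$ for all $f\in B^p$. For an arc $I\subset\partial\mathbb{D}$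 of length $|I|\in(0,2\pi]$ let $S(I)=\{re^{i\theta}: e^{i\theta}\in I,\ 1-\frac{|I|}{2\pi}\le r<1\}$. For $\gamma\ge 0$, a positive Borel measure $\mu$ on $[0,1)$ is called a $\gamma$-logarithmic $1$-Carleson measure if there is a constant $C$ such that $$\mu\big(S(I)\cap[0,1)\big)\Big(\log\frac{2\pi}{|I|}\Big)^{\gamma}\le C\,|I|\qquad\text{for every arc } I\subset\partial\mathbb{D},$$ with the convention $0^0=1$. **Theorem.** Let $1<p<\infty$ and let $\mu$ be a positive Borel measure on $[0,1)$ such that $\mathcal{H}_\mu$ is bounded from $B^p$ into itself. Then $\mu$ is a $\gamma$-logarithmic $1$-Carleson measure for every $\gamma$ with $0\le\gamma<1-\frac1p$. -/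

import Mathlib

noncomputable section

namespace BesovHankel

open MeasureTheory Filter Topology
open scoped ENNReal NNReal

/-! ### Analytic Besov spaces on the unit disc -/

/-- `ρ_p(f)^p = ∫_𝔻 (1 - |z|²)^(p-2) |f'(z)|^p dA(z)`, as an extended nonnegative number. -/
def rhoPow (p : ℝ) (f : ℂ → ℂ) : ℝ≥0∞ :=
  ∫⁻ z in Metric.ball (0 : ℂ) 1,
    ENNReal.ofReal ((1 - ‖z‖ ^ 2) ^ (p - 2) * ‖deriv f z‖ ^ p)

/-- `‖f‖_{B^p} = (|f(0)|^p + ρ_p(f)^p)^(1/p)`, possibly infinite. -/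
def besovNorm (p : ℝ) (f : ℂ → ℂ) : ℝ≥0∞ :=
  (ENNReal.ofReal (‖f 0‖ ^ p) + rhoPow p f) ^ (1 / p)

/-- `f ∈ B^p`: `f` is analytic in the open unit disc and has finite norm.
Only the values of `f` on the disc matter. -/
def MemBesov (p : ℝ) (f : ℂ → ℂ) : Prop :=
  DifferentiableOn ℂ f (Metric.ball (0 : ℂ) 1) ∧ besovNorm p f < ∞

/-! ### The operator given by the Hankel matrix of moments -/

/-- The moment `μ_n = ∫_{[0,1)} t^n dμ(t)`. -/
def moment (μ : Measure (Set.Ico (0 : ℝ) 1)) (n : ℕ) : ℝ :=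
  ∫ t, (t : ℝ) ^ n ∂μ

/-- The Taylor coefficient `a_k` of `f` at the origin. -/
def taylorCoeff (f : ℂ → ℂ) (k : ℕ) : ℂ :=
  iteratedDeriv k f 0 / (k.factorial : ℂ)

/-- `𝓗_μ(f)` makes sense and equals `g` on the unit disc: all moments of `μ` are finite, for each
`n` the series `∑_k μ_{n+k} a_k` converges (in the usual sense, not necessarily absolutely) to some
`c_n`, and `∑_n c_n z^n` converges to `g z` for every `z` in the disc
(so that `g` is analytic there). -/
def IsHankelImage (μ : Measure (Set.Ico (0 : ℝ) 1)) (f g : ℂ → ℂ) : Prop :=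
  (∀ n : ℕ, Integrable (fun t : Set.Ico (0 : ℝ) 1 => (t : ℝ) ^ n) μ) ∧
  ∃ c : ℕ → ℂ,
    (∀ n : ℕ, Tendsto
      (fun N : ℕ => ∑ k ∈ Finset.range N, (moment μ (n + k) : ℂ) * taylorCoeff f k)
      atTop (𝓝 (c n))) ∧
    ∀ z ∈ Metric.ball (0 : ℂ) 1, HasSum (fun n : ℕ => c n * z ^ n) (g z)

/-- `𝓗_μ` is a bounded operator from `B^p` into itself. -/
def HankelBoundedOnBesov (p : ℝ) (μ : Measure (Set.Ico (0 : ℝ) 1)) : Prop :=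
  ∃ C : ℝ≥0, ∀ f : ℂ → ℂ, MemBesov p f →
    ∃ g : ℂ → ℂ, IsHankelImage μ f g ∧ MemBesov p g ∧ besovNorm p g ≤ C * besovNorm p f

/-! ### Logarithmic Carleson measures -/

/-- The Carleson square `S(I) = {r e^{iθ} : e^{iθ} ∈ I, 1 - |I|/2π ≤ r < 1}` over the arc
`I = {e^{iθ} : θ ∈ J}`, where `J` is an interval of length `|J| = |I| ≤ 2π`. -/
def carlesonSquare (J : Set ℝ) : Set ℂ :=
  {z | ∃ r θ : ℝ, θ ∈ J ∧ 1 - volume.real J / (2 * Real.pi) ≤ r ∧ 0 ≤ r ∧ r < 1 ∧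
    z = (r : ℂ) * Complex.exp ((θ : ℂ) * Complex.I)}

/-- `ν` (a Borel measure on the disc) is an `α`-logarithmic `s`-Carleson measure:
`ν(S(I)) (log (2π/|I|))^α ≤ C |I|^s` for every arc `I` of the unit circle. The arc is
parametrised by an interval `J` of angles (open, closed or half-open) with `0 < |J| ≤ 2π`. -/
def IsLogCarleson (α s : ℝ) (ν : Measure ℂ) : Prop :=
  ∃ C : ℝ≥0, ∀ J : Set ℝ, J.OrdConnected → 0 < volume J →
    volume J ≤ ENNReal.ofReal (2 * Real.pi) →
    ν (carlesonSquare J) * ENNReal.ofReal (Real.log (2 * Real.pi / volume.real J) ^ α)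
      ≤ C * ENNReal.ofReal (volume.real J ^ s)

/-- A measure on `[0,1)` seen as a measure on the disc, `A ↦ μ(A ∩ [0,1))`. -/
def toDisc (μ : Measure (Set.Ico (0 : ℝ) 1)) : Measure ℂ :=
  μ.map (fun t : Set.Ico (0 : ℝ) 1 => ((t : ℝ) : ℂ))

end BesovHankel

end

open MeasureTheory Filter Topology Set
open scoped ENNReal NNReal

namespace BesovHankel

/-! ### Integration in polar coordinates and the area mean value inequality -/

/-! Test the operator on `f z = -log (1 - b z)` with `b = 1 - h`, and write `M` for the `μ`-mass of
`[b, 1)` and `l = log (1/h)`. Up to constants, for small `h`: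

Upper bound. In polar coordinates the integral of `(1 - |z|²)^(p-2) |b / (1 - b z)|^p` is at most of
order `l` (`exists_rhoPow_neg_log_le`), so `‖f‖ ≲ l^(1/p)`. Subharmonicity of `|g'|^p` gives `(1 -
|a|) |g' a| ≲ ‖g‖` for every `g` in `B^p` (`ofReal_mul_norm_deriv_rpow_le_rhoPow`). For `g = 𝓗_μ f`
and `a = b` this yields `h |g' b| ≲ l^(1/p)`.

Lower bound. Since `μ_{n+k} ≥ M b^(n+k)`, the coefficients of `g` satisfy `Re c_n ≥ M b^n ∑ b^(2k)/k
= M b^n log (1/(1 - b²))` (`re_coeff_ge`). So `g` dominates a multiple of `1/(1 - b z)`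
coefficientwise, whence `|g' b| ≳ M l / h²` (`le_norm_deriv_of_coeff_ge`).

Together `M l^(1 - 1/p) ≲ h`, which is the tail form of the Carleson condition. The argument reaches
even the endpoint `γ = 1 - 1/p`. -/

theorem lintegral_eq_lintegral_polar {G : ℂ → ℝ≥0∞} (hG : Measurable G) :
    ∫⁻ z, G z = ∫⁻ r in Ioi (0 : ℝ), ENNReal.ofReal r *
      ∫⁻ θ in Ioo (-Real.pi) Real.pi, G (circleMap 0 r θ) := by
  have hc : Continuous fun x : ℝ × ℝ => circleMap 0 x.1 x.2 := by
    unfold circleMap; fun_prop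
  rw [← Complex.lintegral_comp_polarCoord_symm, polarCoord_target,
    Measure.volume_eq_prod, ← Measure.prod_restrict]
  have h : ∀ x : ℝ × ℝ, Complex.polarCoord.symm x = circleMap 0 x.1 x.2 := by
    intro x
    simp [Complex.polarCoord_symm_apply, circleMap, Complex.exp_mul_I]
  simp only [h, smul_eq_mul]
  rw [lintegral_prod]
  · refine lintegral_congr fun r => ?_
    dsimp only
    rw [lintegral_const_mul]
    exact hG.comp (continuous_circleMap 0 r).measurable
  · exact ((ENNReal.measurable_ofReal.comp measurable_fst).mul
      (hG.comp hc.measurable)).aemeasurable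

theorem enorm_mul_two_pi_le_lintegral_circle {F : ℂ → ℂ} {c : ℂ} {r R : ℝ} (hr : 0 < r)
    (hrR : r < R) (hF : DifferentiableOn ℂ F (Metric.ball c R)) :
    ‖F c‖ₑ * ENNReal.ofReal (2 * Real.pi) ≤
      ∫⁻ θ in Ioo (-Real.pi) Real.pi, ‖F (circleMap c r θ)‖ₑ := by
  have hd : DiffContOnCl ℂ F (Metric.ball c |r|) := by
    apply DifferentiableOn.diffContOnCl
    rw [abs_of_pos hr]
    exact hF.mono (Metric.closure_ball_subset_closedBall.trans
      (Metric.closedBall_subset_ball hrR))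
  have h := hd.circleAverage
  rw [Real.circleAverage_eq_integral_add (-Real.pi),
    intervalIntegral.integral_comp_add_right (fun θ => F (circleMap c r θ))] at h
  have h2 : (2 * Real.pi) • F c = ∫ θ in (-Real.pi)..Real.pi, F (circleMap c r θ) := by
    rw [← h, smul_smul, mul_inv_cancel₀ (by positivity), one_smul]
    congr 1 <;> ring
  have h3 : ‖F c‖ₑ * ENNReal.ofReal (2 * Real.pi) = ‖(2 * Real.pi) • F c‖ₑ := by
    rw [enorm_smul, mul_comm, Real.enorm_of_nonneg (by positivity)]
  rw [h3, h2, intervalIntegral.integral_of_le (by linarith [Real.pi_pos]),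
    integral_Ioc_eq_integral_Ioo]
  exact enorm_integral_le_lintegral_enorm _

theorem enorm_mul_volume_ball_le_lintegral {F : ℂ → ℂ} {c : ℂ} {R : ℝ}
    (hF : DifferentiableOn ℂ F (Metric.ball c R)) :
    ‖F c‖ₑ * volume (Metric.ball c R) ≤ ∫⁻ z in Metric.ball c R, ‖F z‖ₑ := by
  have hm : Measurable ((Metric.ball c R).indicator fun z => ‖F z‖ₑ) := by
    classical
    rw [← piecewise_eq_indicator]
    exact (hF.continuousOn.enorm).measurable_piecewise continuousOn_const
      measurableSet_ball
  -- Polar coordinates are centred at `0`, so both integrands are translated by `c` and then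
  -- compared circle by circle.
  have key : ∫⁻ z, (Metric.ball c R).indicator (fun _ => ‖F c‖ₑ) (z + c) ≤
      ∫⁻ z, (Metric.ball c R).indicator (fun z => ‖F z‖ₑ) (z + c) := by
    rw [lintegral_eq_lintegral_polar
        (G := fun z => (Metric.ball c R).indicator (fun _ => ‖F c‖ₑ) (z + c))
        ((measurable_const.indicator measurableSet_ball).comp (measurable_add_const c)),
      lintegral_eq_lintegral_polar
        (G := fun z => (Metric.ball c R).indicator (fun z => ‖F z‖ₑ) (z + c))
        (hm.comp (measurable_add_const c))]
    refine setLIntegral_mono' measurableSet_Ioi fun r (hr : 0 < r) => ?_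
    gcongr 1
    have hcm : ∀ θ, circleMap 0 r θ + c = circleMap c r θ := fun θ => by
      simp [circleMap, add_comm]
    simp only [hcm]
    by_cases hrR : r < R
    · have hmem : ∀ θ, circleMap c r θ ∈ Metric.ball c R := fun θ => by
        simp [circleMap, abs_of_pos hr, hrR]
      simp only [indicator_of_mem (hmem _)]
      refine le_trans (le_of_eq ?_) (enorm_mul_two_pi_le_lintegral_circle hr hrR hF)
      simp only [lintegral_const, MeasurableSet.univ, Measure.restrict_apply, univ_inter,
        Real.volume_Ioo]
      congr 2; ring
    · have hmem : ∀ θ, circleMap c r θ ∉ Metric.ball c R := fun θ => by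
        simpa [circleMap, abs_of_pos hr] using hrR
      simp only [indicator_of_notMem (hmem _)]
      rfl
  rw [lintegral_add_right_eq_self (fun z => (Metric.ball c R).indicator (fun _ => ‖F c‖ₑ) z) c,
    lintegral_add_right_eq_self (fun z => (Metric.ball c R).indicator (fun z => ‖F z‖ₑ) z) c,
    lintegral_indicator measurableSet_ball, lintegral_indicator measurableSet_ball,
    lintegral_const] at key
  simpa using key

/-- Hölder against the constant `1` bounds the mean of `|F|` by its `L^p` mean; the surplus power of
the volume cancels after raising to the power `p`. -/
theorem enorm_rpow_mul_volume_ball_le_lintegral {p : ℝ} (hp : 1 < p) {F : ℂ → ℂ} {c : ℂ} {R : ℝ}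
    (hR : 0 < R) (hF : DifferentiableOn ℂ F (Metric.ball c R)) :
    ‖F c‖ₑ ^ p * volume (Metric.ball c R) ≤ ∫⁻ z in Metric.ball c R, ‖F z‖ₑ ^ p := by
  have hp0 : 0 < p := by linarith
  set V := volume (Metric.ball c R) with hV
  have hV0 : V ≠ 0 := (Metric.measure_ball_pos volume c hR).ne'
  have hVt : V ≠ ∞ := measure_ball_lt_top.ne
  have hpq := Real.HolderConjugate.conjExponent hp
  set q := p.conjExponent
  have hq : 1 / q = 1 - 1 / p := by
    have := hpq.inv_add_inv_eq_one
    rw [one_div, one_div]; linarith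
  have hm : AEMeasurable (fun z => ‖F z‖ₑ) (volume.restrict (Metric.ball c R)) :=
    hF.continuousOn.enorm.aemeasurable measurableSet_ball
  have h1 := ENNReal.lintegral_mul_le_Lp_mul_Lq (volume.restrict (Metric.ball c R)) hpq hm
    (aemeasurable_const (b := 1))
  simp only [Pi.mul_apply, mul_one, ENNReal.one_rpow, lintegral_one,
    Measure.restrict_apply_univ] at h1
  have h := (enorm_mul_volume_ball_le_lintegral hF).trans h1
  rw [← hV, hq] at h
  have h2 := ENNReal.rpow_le_rpow h hp0.le
  rw [ENNReal.mul_rpow_of_nonneg _ _ hp0.le, ENNReal.mul_rpow_of_nonneg _ _ hp0.le,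
    ← ENNReal.rpow_mul, ← ENNReal.rpow_mul, one_div_mul_cancel hp0.ne', ENNReal.rpow_one,
    sub_mul, one_div_mul_cancel hp0.ne', one_mul, ENNReal.rpow_sub _ _ hV0 hVt,
    ENNReal.rpow_one] at h2
  have hVp0 : V ^ p ≠ 0 := by simp [hV0, hVt]
  have hVpt : V ^ p ≠ ∞ := by simp [hV0, hVt]
  refine (ENNReal.mul_le_mul_iff_left hVp0 hVpt).1 ?_
  calc ‖F c‖ₑ ^ p * V * V ^ p = ‖F c‖ₑ ^ p * V ^ p * V := by ring
    _ ≤ (∫⁻ z in Metric.ball c R, ‖F z‖ₑ ^ p) * (V ^ p / V) * V := by gcongr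
    _ = _ := by rw [mul_assoc, ENNReal.div_mul_cancel hV0 hVt]

/-! ### Power weights -/

/-- The value `6` is a crude common bound: the ratios met below lie in `[1/2, 3]` or `[1, 2]`. Using
`|q|` treats `p < 2` and `p ≥ 2` at once. -/
theorem six_rpow_neg_abs_le_rpow {y q : ℝ} (h1 : 1 / 6 ≤ y) (h2 : y ≤ 6) :
    (6 : ℝ) ^ (-|q|) ≤ y ^ q := by
  have hy : 0 < y := by linarith
  rcases le_total 0 q with hq | hq
  · rw [abs_of_nonneg hq, Real.rpow_neg (by norm_num), ← Real.inv_rpow (by norm_num)]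
    exact Real.rpow_le_rpow (by norm_num) (by linarith) hq
  · rw [abs_of_nonpos hq, neg_neg]
    exact Real.rpow_le_rpow_of_nonpos hy h2 hq

theorem rpow_le_six_rpow_abs {y q : ℝ} (h1 : 1 / 6 ≤ y) (h2 : y ≤ 6) :
    y ^ q ≤ (6 : ℝ) ^ |q| := by
  have hy : 0 < y := by linarith
  have h := six_rpow_neg_abs_le_rpow (q := -q) h1 h2
  rw [abs_neg, Real.rpow_neg (by norm_num), Real.rpow_neg hy.le] at h
  exact (inv_le_inv₀ (by positivity) (by positivity)).1 h

/-! ### Growth of the derivative of a Besov function -/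

/-- On the disc of radius `h / 2` about `a`, where `h = 1 - |a|`, the weight is comparable to
`h^(p-2)`. The mean value inequality for `|g'|^p` there brings in the area `π h² / 4`; the factor
`π` is discarded. -/
theorem ofReal_mul_norm_deriv_rpow_le_rhoPow {p : ℝ} (hp : 1 < p) {g : ℂ → ℂ}
    (hg : DifferentiableOn ℂ g (Metric.ball 0 1)) {a : ℂ} (ha : ‖a‖ < 1) :
    ENNReal.ofReal (6 ^ (-|p - 2|) / 4 * ((1 - ‖a‖) * ‖deriv g a‖) ^ p) ≤ rhoPow p g := by
  set h := 1 - ‖a‖ with hh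
  have hh0 : 0 < h := by linarith
  have hp0 : 0 < p := by linarith
  have hz : ∀ z ∈ Metric.ball a (h / 2), 1 - ‖z‖ ≥ h / 2 ∧ 1 - ‖z‖ ≤ 3 * h / 2 := by
    intro z hz
    rw [Metric.mem_ball, dist_eq_norm] at hz
    have h1 := norm_sub_norm_le z a
    have h2 := norm_sub_norm_le a z
    rw [norm_sub_rev] at h2
    constructor <;> linarith
  have hsub : Metric.ball a (h / 2) ⊆ Metric.ball (0 : ℂ) 1 := by
    intro z hz'
    rw [mem_ball_zero_iff]
    linarith [(hz z hz').1]
  have hd : DifferentiableOn ℂ (deriv g) (Metric.ball a (h / 2)) :=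
    (hg.deriv Metric.isOpen_ball).mono hsub
  have hmv := enorm_rpow_mul_volume_ball_le_lintegral hp (half_pos hh0) hd
  have hw : ∀ z ∈ Metric.ball a (h / 2),
      ENNReal.ofReal (6 ^ (-|p - 2|) * h ^ (p - 2)) * ‖deriv g z‖ₑ ^ p ≤
        ENNReal.ofReal ((1 - ‖z‖ ^ 2) ^ (p - 2) * ‖deriv g z‖ ^ p) := by
    intro z hz'
    obtain ⟨h1, h2⟩ := hz z hz'
    have hn := norm_nonneg z
    rw [← ofReal_norm, ENNReal.ofReal_rpow_of_nonneg (norm_nonneg _) hp0.le,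
      ← ENNReal.ofReal_mul (by positivity)]
    gcongr
    have h3 : h / 2 ≤ 1 - ‖z‖ ^ 2 := by nlinarith
    have h4 : 1 - ‖z‖ ^ 2 ≤ 3 * h := by nlinarith
    have h5 := six_rpow_neg_abs_le_rpow (y := (1 - ‖z‖ ^ 2) / h) (q := p - 2)
      (by rw [le_div_iff₀ hh0]; linarith) (by rw [div_le_iff₀ hh0]; linarith)
    rwa [Real.div_rpow (by linarith) hh0.le, le_div_iff₀ (by positivity)] at h5
  calc ENNReal.ofReal (6 ^ (-|p - 2|) / 4 * (h * ‖deriv g a‖) ^ p)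
      ≤ ENNReal.ofReal (6 ^ (-|p - 2|) * h ^ (p - 2)) *
        (‖deriv g a‖ₑ ^ p * volume (Metric.ball a (h / 2))) := by
        rw [Complex.volume_ball, ← ofReal_norm,
          ENNReal.ofReal_rpow_of_nonneg (norm_nonneg _) hp0.le,
          ← ENNReal.ofReal_pow (by positivity),
          ← ENNReal.ofReal_coe_nnreal, ← ENNReal.ofReal_mul (by positivity),
          ← ENNReal.ofReal_mul (by positivity), ← ENNReal.ofReal_mul (by positivity)]
        apply ENNReal.ofReal_le_ofReal
        have e : h ^ p = h ^ (p - 2) * h ^ 2 := by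
          rw [← Real.rpow_natCast, ← Real.rpow_add hh0]; norm_num
        rw [Real.mul_rpow hh0.le (norm_nonneg _), e, NNReal.coe_real_pi]
        have : 0 ≤ 6 ^ (-|p - 2|) / 4 * (h ^ (p - 2) * h ^ 2 * ‖deriv g a‖ ^ p) := by
          positivity
        nlinarith [Real.pi_gt_three]
    _ ≤ ENNReal.ofReal (6 ^ (-|p - 2|) * h ^ (p - 2)) *
        ∫⁻ z in Metric.ball a (h / 2), ‖deriv g z‖ₑ ^ p := by gcongr
    _ = ∫⁻ z in Metric.ball a (h / 2),
        ENNReal.ofReal (6 ^ (-|p - 2|) * h ^ (p - 2)) * ‖deriv g z‖ₑ ^ p := by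
        rw [lintegral_const_mul' _ _ ENNReal.ofReal_ne_top]
    _ ≤ ∫⁻ z in Metric.ball a (h / 2),
        ENNReal.ofReal ((1 - ‖z‖ ^ 2) ^ (p - 2) * ‖deriv g z‖ ^ p) :=
        setLIntegral_mono' measurableSet_ball hw
    _ ≤ rhoPow p g := lintegral_mono_set hsub

/-! ### The Besov norm of logarithms -/

theorem one_sub_add_abs_le_norm {ρ θ : ℝ} (h0 : 0 ≤ ρ) (h1 : ρ < 1) (hθ : |θ| ≤ Real.pi) :
    1 - ρ + |θ| ≤ 8 * ‖1 - circleMap 0 ρ θ‖ := by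
  have hn : ‖1 - circleMap 0 ρ θ‖ ^ 2 = (1 - ρ) ^ 2 + 2 * ρ * (1 - Real.cos θ) := by
    rw [← Complex.normSq_eq_norm_sq, Complex.normSq_apply]
    simp only [circleMap, Complex.exp_mul_I, zero_add, Complex.sub_re, Complex.one_re,
      Complex.sub_im, Complex.one_im, Complex.ofReal_re, Complex.ofReal_im,
      Complex.add_re, Complex.add_im, Complex.cos_ofReal_re, Complex.cos_ofReal_im,
      Complex.mul_re, Complex.mul_im, Complex.sin_ofReal_re, Complex.sin_ofReal_im,
      Complex.I_re, Complex.I_im]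
    nlinarith [Real.sin_sq_add_cos_sq θ]
  have hc := Real.cos_le_one_sub_mul_cos_sq hθ
  have hpi := Real.pi_gt_three
  have hpi4 := Real.pi_lt_d2
  have hc2 : 1 / 5 * θ ^ 2 ≤ 1 - Real.cos θ := by
    have : 1 / 5 ≤ 2 / Real.pi ^ 2 := by
      rw [div_le_div_iff₀ (by norm_num) (by positivity)]; nlinarith
    nlinarith [sq_nonneg θ]
  refine abs_le_of_sq_le_sq' ?_ (by positivity) |>.2
  rw [mul_pow, hn]
  have ha := abs_nonneg θ
  rw [← sq_abs θ] at hc2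
  -- For `ρ ≥ 1/2` the cosine term controls `θ²`. For `ρ ≤ 1/2` it is not needed, since `|θ| ≤ π ≤
  -- 7/2 ≤ 7 (1 - ρ)`.
  rcases le_total (1 / 2) ρ with h | h
  · nlinarith [sq_nonneg (1 - ρ - |θ|), mul_nonneg (by linarith : 0 ≤ ρ - 1 / 2)
      (by nlinarith : 0 ≤ 1 - Real.cos θ)]
  · nlinarith [mul_nonneg h0 (by nlinarith : 0 ≤ 1 - Real.cos θ)]

theorem lintegral_rpow_add_abs_le {p d : ℝ} (hp : 1 < p) (hd : 0 < d) :
    ∫⁻ θ in Ioo (-Real.pi) Real.pi, ENNReal.ofReal ((d + |θ|) ^ (-p)) ≤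
      ENNReal.ofReal (2 / (p - 1) * d ^ (1 - p)) := by
  have hpi := Real.pi_pos
  have hcont : Continuous fun θ : ℝ => (d + |θ|) ^ (-p) :=
    (by fun_prop : Continuous fun θ : ℝ => d + |θ|).rpow_const
      fun θ => Or.inl (by positivity)
  have hhalf : ∫ θ in (0 : ℝ)..Real.pi, (d + |θ|) ^ (-p) ≤ 1 / (p - 1) * d ^ (1 - p) := by
    have e : ∫ θ in (0 : ℝ)..Real.pi, (d + |θ|) ^ (-p) =
        ∫ θ in (0 : ℝ)..Real.pi, (d + θ) ^ (-p) := by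
      refine intervalIntegral.integral_congr fun θ hθ => ?_
      rw [uIcc_of_le hpi.le] at hθ
      simp only [abs_of_nonneg hθ.1]
    rw [e, intervalIntegral.integral_comp_add_left (fun x => x ^ (-p)) d, add_zero,
      integral_rpow (Or.inr ⟨by linarith, by
        rw [uIcc_of_le (by linarith)]; exact fun h => by linarith [h.1]⟩)]
    rw [show -p + 1 = -(p - 1) by ring, div_neg, ← neg_div, neg_sub, show 1 - p = -(p - 1) by ring,
      one_div, inv_mul_eq_div]
    gcongr
    linarith [Real.rpow_nonneg (by linarith : 0 ≤ d + Real.pi) (-(p - 1))]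
  have hneg : ∫ θ in (-Real.pi)..0, (d + |θ|) ^ (-p) =
      ∫ θ in (0 : ℝ)..Real.pi, (d + |θ|) ^ (-p) := by
    rw [← neg_zero, ← intervalIntegral.integral_comp_neg, neg_zero]
    simp
  rw [← ofReal_integral_eq_lintegral_ofReal
      (hcont.integrableOn_Icc.mono_set Ioo_subset_Icc_self) (ae_of_all _ fun θ => by positivity),
    ← integral_Ioc_eq_integral_Ioo, ← intervalIntegral.integral_of_le (by linarith),
    ← intervalIntegral.integral_add_adjacent_intervals (hcont.intervalIntegrable _ 0)
      (hcont.intervalIntegrable 0 _), hneg]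
  apply ENNReal.ofReal_le_ofReal
  rw [show 2 / (p - 1) * d ^ (1 - p) = 2 * (1 / (p - 1) * d ^ (1 - p)) by ring]
  linarith

/-- Split at `r = 1 - h`. Before it the integrand collapses to `1 / (1 - r)` and produces the
logarithm; after it `h^(1-p)` exactly balances the integral of `(1 - r)^(p-2)`, which converges
because `p > 1`. -/
theorem lintegral_rpow_mul_max_rpow_le {p h : ℝ} (hp : 1 < p) (h0 : 0 < h) (h1 : h < 1) :
    ∫⁻ r in Ioo (0 : ℝ) 1, ENNReal.ofReal ((1 - r) ^ (p - 2) * (max (1 - r) h) ^ (1 - p)) ≤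
      ENNReal.ofReal (1 / (p - 1) + Real.log (1 / h)) := by
  have hnear : ∫⁻ r in Ioc (1 - h) 1, ENNReal.ofReal ((1 - r) ^ (p - 2) * h ^ (1 - p)) =
      ENNReal.ofReal (1 / (p - 1)) := by
    have hi : IntervalIntegrable (fun r : ℝ => (1 - r) ^ (p - 2) * h ^ (1 - p)) volume (1 - h) 1 := by
      have := (intervalIntegral.intervalIntegrable_rpow' (a := h) (b := 0) (r := p - 2)
        (by linarith)).comp_sub_left 1
      rw [sub_zero] at this
      exact this.mul_const _
    rw [← ofReal_integral_eq_lintegral_ofReal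
      ((intervalIntegrable_iff_integrableOn_Ioc_of_le (by linarith)).1 hi)]
    · rw [← intervalIntegral.integral_of_le (by linarith), intervalIntegral.integral_mul_const,
        intervalIntegral.integral_comp_sub_left (fun s => s ^ (p - 2)), sub_self, sub_sub_cancel,
        integral_rpow (Or.inl (by linarith)), Real.zero_rpow (by linarith), sub_zero,
        show p - 2 + 1 = p - 1 by ring, div_mul_eq_mul_div, ← Real.rpow_add h0]
      norm_num
    · refine (ae_restrict_iff' measurableSet_Ioc).2 (ae_of_all _ fun r hr => ?_)
      exact mul_nonneg (Real.rpow_nonneg (by linarith [hr.2]) _) (Real.rpow_nonneg h0.le _)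
  have hfar : ∫⁻ r in Ioc 0 (1 - h), ENNReal.ofReal ((1 - r)⁻¹) =
      ENNReal.ofReal (Real.log (1 / h)) := by
    have hi : IntervalIntegrable (fun r : ℝ => (1 - r)⁻¹) volume 0 (1 - h) := by
      refine ContinuousOn.intervalIntegrable (ContinuousOn.inv₀ (by fun_prop) fun r hr => ?_)
      rw [uIcc_of_le (by linarith)] at hr
      linarith [hr.2]
    rw [← ofReal_integral_eq_lintegral_ofReal
      ((intervalIntegrable_iff_integrableOn_Ioc_of_le (by linarith)).1 hi)]
    · rw [← intervalIntegral.integral_of_le (by linarith),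
        intervalIntegral.integral_comp_sub_left (fun s => s⁻¹), sub_zero, sub_sub_cancel,
        integral_inv_of_pos h0 one_pos]
    · refine (ae_restrict_iff' measurableSet_Ioc).2 (ae_of_all _ fun r hr => ?_)
      exact inv_nonneg.2 (by linarith [hr.2])
  calc _ ≤ ∫⁻ r in Ioc 0 (1 - h) ∪ Ioo (1 - h) 1,
        ENNReal.ofReal ((1 - r) ^ (p - 2) * (max (1 - r) h) ^ (1 - p)) := by
        refine lintegral_mono_set fun r hr => ?_
        rcases le_or_gt r (1 - h) with h' | h'
        · exact Or.inl ⟨hr.1, h'⟩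
        · exact Or.inr ⟨h', hr.2⟩
    _ ≤ _ := lintegral_union_le _ _ _
    _ ≤ (∫⁻ r in Ioc 0 (1 - h), ENNReal.ofReal ((1 - r)⁻¹)) +
        ∫⁻ r in Ioc (1 - h) 1, ENNReal.ofReal ((1 - r) ^ (p - 2) * h ^ (1 - p)) := by
        gcongr ?_ + ?_
        · refine setLIntegral_mono' measurableSet_Ioc fun r hr => ?_
          have hr' : 0 < 1 - r := by linarith [hr.2]
          rw [max_eq_left (by linarith [hr.2]), ← Real.rpow_add hr',
            show p - 2 + (1 - p) = -1 by ring, Real.rpow_neg_one]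
        · refine (setLIntegral_mono' measurableSet_Ioo fun r hr => ?_).trans
            (lintegral_mono_set Ioo_subset_Ioc_self)
          rw [max_eq_right (by linarith [hr.1])]
    _ = _ := by
      rw [hnear, hfar, add_comm, ENNReal.ofReal_add]
      · exact one_div_nonneg.2 (by linarith)
      · exact Real.log_nonneg (by rw [le_div_iff₀ h0]; linarith)

theorem one_sub_mul_mem_slitPlane {b : ℝ} (hb0 : 0 < b) (hb1 : b < 1) {z : ℂ} (hz : ‖z‖ < 1) :
    1 - b * z ∈ Complex.slitPlane := by
  refine Complex.mem_slitPlane_of_norm_lt_one (z := -(b * z)) ?_ |> fun h => by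
    rwa [← sub_eq_add_neg] at h
  rw [norm_neg, norm_mul, Complex.norm_of_nonneg hb0.le]
  nlinarith [norm_nonneg z]

theorem hasDerivAt_neg_log_one_sub_mul {b : ℝ} (hb0 : 0 < b) (hb1 : b < 1) {z : ℂ}
    (hz : ‖z‖ < 1) :
    HasDerivAt (fun z : ℂ => -Complex.log (1 - b * z)) (b / (1 - b * z)) z := by
  have h := (((hasDerivAt_id z).const_mul (b : ℂ)).const_sub 1).clog
    (one_sub_mul_mem_slitPlane hb0 hb1 hz)
  convert! h.neg using 1
  simp [neg_div]

/-- The case `k = 0` is included: division by zero returns `0`, which is the value of the function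
at the origin. -/
theorem taylorCoeff_neg_log_one_sub_mul {b : ℝ} (hb0 : 0 < b) (hb1 : b < 1) (k : ℕ) :
    taylorCoeff (fun z : ℂ => -Complex.log (1 - b * z)) k = ((b ^ k / k : ℝ) : ℂ) := by
  set f : ℂ → ℂ := fun z => -Complex.log (1 - b * z)
  have hd : DifferentiableOn ℂ f (Metric.ball 0 1) := fun z hz =>
    (hasDerivAt_neg_log_one_sub_mul hb0 hb1
      (mem_ball_zero_iff.1 hz)).differentiableAt.differentiableWithinAt
  have h1 := (hd.analyticAt (Metric.ball_mem_nhds 0 one_pos)).hasFPowerSeriesAt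
  have h2 : HasFPowerSeriesAt f
      (FormalMultilinearSeries.ofScalars ℂ fun k => ((b ^ k / k : ℝ) : ℂ)) 0 := by
    rw [hasFPowerSeriesAt_iff]
    filter_upwards [Metric.ball_mem_nhds (0 : ℂ) one_pos] with z hz
    rw [mem_ball_zero_iff] at hz
    have hbz : ‖(b : ℂ) * z‖ < 1 := by
      rw [norm_mul, Complex.norm_of_nonneg hb0.le]
      nlinarith [norm_nonneg z]
    rw [zero_add]
    convert! Complex.hasSum_taylorSeries_neg_log hbz using 2 with n
    simp [FormalMultilinearSeries.coeff_ofScalars, mul_pow]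
    ring
  have h3 := congrArg (fun q => q.coeff k) (h1.eq_formalMultilinearSeries h2)
  rw [FormalMultilinearSeries.coeff_ofScalars, FormalMultilinearSeries.coeff_ofScalars] at h3
  exact h3

/-- The angular integral of `|1 - b r e^{iθ}|^(-p)` is of order at most `(1 - b r)^(1-p)`, and `1 -
b r` dominates both `1 - r` and `h`. What remains is the radial integral
`lintegral_rpow_mul_max_rpow_le`. -/
theorem exists_rhoPow_neg_log_le {p : ℝ} (hp : 1 < p) :
    ∃ K : ℝ, 0 < K ∧ ∀ h : ℝ, 0 < h → h < 1 →
      rhoPow p (fun z : ℂ => -Complex.log (1 - ((1 - h : ℝ) : ℂ) * z)) ≤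
        ENNReal.ofReal (K * (1 / (p - 1) + Real.log (1 / h))) := by
  have hp1 : 0 < p - 1 := by linarith
  refine ⟨6 ^ |p - 2| * 8 ^ p * (2 / (p - 1)), by positivity, fun h h0 h1 => ?_⟩
  set b : ℝ := 1 - h with hb
  have hb0 : 0 < b := by linarith
  have hb1 : b < 1 := by linarith
  set G : ℂ → ℝ≥0∞ := (Metric.ball (0 : ℂ) 1).indicator fun z =>
    ENNReal.ofReal ((1 - ‖z‖ ^ 2) ^ (p - 2) * ‖(b : ℂ) / (1 - b * z)‖ ^ p) with hG
  have hGm : Measurable G := by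
    refine Measurable.indicator ?_ measurableSet_ball
    fun_prop
  have hrho : rhoPow p (fun z : ℂ => -Complex.log (1 - (b : ℂ) * z)) = ∫⁻ z, G z := by
    rw [hG, lintegral_indicator measurableSet_ball, rhoPow]
    refine setLIntegral_congr_fun measurableSet_ball fun z hz => ?_
    rw [(hasDerivAt_neg_log_one_sub_mul hb0 hb1 (mem_ball_zero_iff.1 hz)).deriv]
  have hcirc : ∀ r ∈ Ioo (0 : ℝ) 1,
      ENNReal.ofReal r * ∫⁻ θ in Ioo (-Real.pi) Real.pi, G (circleMap 0 r θ) ≤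
      ENNReal.ofReal (6 ^ |p - 2| * 8 ^ p * (2 / (p - 1))) *
        ENNReal.ofReal ((1 - r) ^ (p - 2) * (max (1 - r) h) ^ (1 - p)) := by
    rintro r ⟨hr0, hr1⟩
    have hr1' : 0 < 1 - r := by linarith
    have hd : 0 < 1 - b * r := by nlinarith
    have hbr : b * r < 1 := by linarith
    have hpt : ∀ θ ∈ Ioo (-Real.pi) Real.pi, G (circleMap 0 r θ) ≤
        ENNReal.ofReal (6 ^ |p - 2| * (1 - r) ^ (p - 2) * 8 ^ p) *
          ENNReal.ofReal ((1 - b * r + |θ|) ^ (-p)) := by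
      intro θ hθ
      have hn : ‖circleMap 0 r θ‖ = r := by simp [circleMap, abs_of_pos hr0]
      have hm : circleMap 0 r θ ∈ Metric.ball (0 : ℂ) 1 := by rwa [mem_ball_zero_iff, hn]
      rw [hG, indicator_of_mem hm, hn, ← ENNReal.ofReal_mul (by positivity)]
      apply ENNReal.ofReal_le_ofReal
      have hlow := one_sub_add_abs_le_norm (mul_pos hb0 hr0).le hbr
        (abs_le.2 ⟨hθ.1.le, hθ.2.le⟩)
      have hbc : (b : ℂ) * circleMap 0 r θ = circleMap 0 (b * r) θ := by
        simp [circleMap, mul_assoc]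
      have hX : 0 < 1 - b * r + |θ| := by positivity
      have hw : (1 - r ^ 2) ^ (p - 2) ≤ 6 ^ |p - 2| * (1 - r) ^ (p - 2) := by
        rw [show 1 - r ^ 2 = (1 + r) * (1 - r) by ring,
          Real.mul_rpow (by linarith) hr1'.le]
        gcongr
        exact rpow_le_six_rpow_abs (by linarith) (by linarith)
      have hq : ‖(b : ℂ) / (1 - b * circleMap 0 r θ)‖ ^ p ≤
          8 ^ p * (1 - b * r + |θ|) ^ (-p) := by
        rw [Real.rpow_neg hX.le, ← Real.inv_rpow hX.le, ← Real.mul_rpow (by norm_num)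
          (by positivity), hbc]
        refine Real.rpow_le_rpow (norm_nonneg _) ?_ (by linarith)
        rw [norm_div, Complex.norm_of_nonneg hb0.le, ← div_eq_mul_inv,
          div_le_div_iff₀ (by linarith) hX]
        nlinarith
      calc _ ≤ (6 ^ |p - 2| * (1 - r) ^ (p - 2)) * (8 ^ p * (1 - b * r + |θ|) ^ (-p)) :=
            mul_le_mul hw hq (by positivity) (by positivity)
        _ = _ := by ring
    calc ENNReal.ofReal r * ∫⁻ θ in Ioo (-Real.pi) Real.pi, G (circleMap 0 r θ)
        ≤ 1 * ∫⁻ θ in Ioo (-Real.pi) Real.pi,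
          ENNReal.ofReal (6 ^ |p - 2| * (1 - r) ^ (p - 2) * 8 ^ p) *
            ENNReal.ofReal ((1 - b * r + |θ|) ^ (-p)) := by
          refine mul_le_mul' (ENNReal.ofReal_le_one.2 hr1.le) ?_
          exact setLIntegral_mono' measurableSet_Ioo hpt
      _ ≤ ENNReal.ofReal (6 ^ |p - 2| * (1 - r) ^ (p - 2) * 8 ^ p) *
          ENNReal.ofReal (2 / (p - 1) * (1 - b * r) ^ (1 - p)) := by
          rw [one_mul, lintegral_const_mul' _ _ ENNReal.ofReal_ne_top]
          gcongr
          exact lintegral_rpow_add_abs_le hp hd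
      _ ≤ _ := by
          rw [← ENNReal.ofReal_mul (by positivity), ← ENNReal.ofReal_mul (by positivity)]
          apply ENNReal.ofReal_le_ofReal
          have hmx : (1 - b * r) ^ (1 - p) ≤ (max (1 - r) h) ^ (1 - p) := by
            refine Real.rpow_le_rpow_of_nonpos (lt_max_of_lt_left hr1') ?_ (by linarith)
            exact max_le (by nlinarith) (by nlinarith)
          calc _ = 6 ^ |p - 2| * 8 ^ p * (2 / (p - 1)) *
                ((1 - r) ^ (p - 2) * (1 - b * r) ^ (1 - p)) := by ring
            _ ≤ _ := by gcongr
  rw [hrho, lintegral_eq_lintegral_polar hGm]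
  have hsupp : ∀ r ∈ Ioi (0 : ℝ),
      ENNReal.ofReal r * ∫⁻ θ in Ioo (-Real.pi) Real.pi, G (circleMap 0 r θ) ≤
      (Ioo (0 : ℝ) 1).indicator (fun r => ENNReal.ofReal (6 ^ |p - 2| * 8 ^ p * (2 / (p - 1))) *
        ENNReal.ofReal ((1 - r) ^ (p - 2) * (max (1 - r) h) ^ (1 - p))) r := by
    intro r hr
    by_cases hr1 : r < 1
    · rw [indicator_of_mem (show r ∈ Ioo (0 : ℝ) 1 from ⟨hr, hr1⟩)]
      exact hcirc r ⟨hr, hr1⟩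
    · have hm : ∀ θ, circleMap 0 r θ ∉ Metric.ball (0 : ℂ) 1 := fun θ => by
        simpa [circleMap, abs_of_pos (show 0 < r from hr)] using hr1
      have hz : ∀ θ, G (circleMap 0 r θ) = 0 := fun θ => indicator_of_notMem (hm θ) _
      simp [hz]
  calc _ ≤ _ := setLIntegral_mono' measurableSet_Ioi hsupp
    _ ≤ _ := setLIntegral_le_lintegral _ _
    _ = _ := lintegral_indicator measurableSet_Ioo _
    _ = _ := lintegral_const_mul' _ _ ENNReal.ofReal_ne_top
    _ ≤ ENNReal.ofReal (6 ^ |p - 2| * 8 ^ p * (2 / (p - 1))) *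
        ENNReal.ofReal (1 / (p - 1) + Real.log (1 / h)) := by
        gcongr
        exact lintegral_rpow_mul_max_rpow_le hp h0 h1
    _ = _ := by rw [← ENNReal.ofReal_mul (by positivity)]

theorem besovNorm_neg_log_one_sub_mul {p : ℝ} (hp : 1 < p) (b : ℝ) :
    besovNorm p (fun z : ℂ => -Complex.log (1 - b * z)) =
      rhoPow p (fun z : ℂ => -Complex.log (1 - b * z)) ^ (1 / p) := by
  simp [besovNorm, Real.zero_rpow (by linarith : p ≠ 0)]

/-! ### Lower bounds for the image of a logarithm -/

theorem real_mul_pow_le_moment {μ : Measure (Ico (0 : ℝ) 1)} [IsFiniteMeasure μ]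
    {b : ℝ} (hb : 0 ≤ b) {n : ℕ}
    (hint : Integrable (fun t : Ico (0 : ℝ) 1 => (t : ℝ) ^ n) μ) :
    μ.real {t | b ≤ (t : ℝ)} * b ^ n ≤ moment μ n := by
  have hs : MeasurableSet {t : Ico (0 : ℝ) 1 | b ≤ (t : ℝ)} :=
    measurableSet_le measurable_const measurable_subtype_coe
  calc μ.real {t | b ≤ (t : ℝ)} * b ^ n = ∫ t in {t : Ico (0 : ℝ) 1 | b ≤ (t : ℝ)}, b ^ n ∂μ := by
        simp
    _ ≤ ∫ t in {t : Ico (0 : ℝ) 1 | b ≤ (t : ℝ)}, (t : ℝ) ^ n ∂μ :=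
        setIntegral_mono_on (integrable_const _).integrableOn hint.integrableOn hs
          fun t ht => pow_le_pow_left₀ hb ht n
    _ ≤ moment μ n := setIntegral_le_integral hint (ae_of_all _ fun t => pow_nonneg t.2.1 n)

theorem re_coeff_ge {μ : Measure (Ico (0 : ℝ) 1)} [IsFiniteMeasure μ]
    (hint : ∀ n : ℕ, Integrable (fun t : Ico (0 : ℝ) 1 => (t : ℝ) ^ n) μ)
    {b : ℝ} (hb0 : 0 < b) (hb1 : b < 1) {n : ℕ} {c : ℂ}
    (hc : Tendsto (fun N : ℕ => ∑ k ∈ Finset.range N, (moment μ (n + k) : ℂ) *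
      taylorCoeff (fun z : ℂ => -Complex.log (1 - b * z)) k) atTop (𝓝 c)) :
    μ.real {t | b ≤ (t : ℝ)} * -Real.log (1 - b ^ 2) * b ^ n ≤ c.re := by
  have h1 := (Complex.continuous_re.tendsto c).comp hc
  have hb2 : |b ^ 2| < 1 := by
    rw [abs_of_nonneg (by positivity)]; nlinarith
  have h2 : Tendsto (fun N : ℕ => ∑ k ∈ Finset.range N, (b ^ 2) ^ k / (k : ℝ)) atTop
      (𝓝 (-Real.log (1 - b ^ 2))) := by
    have h := Real.hasSum_pow_div_log_of_abs_lt_one hb2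
    have h' : HasSum (fun k : ℕ => (b ^ 2) ^ k / (k : ℝ)) (-Real.log (1 - b ^ 2)) := by
      -- The usual logarithm series starts at `k = 1`; the extra term `1 / 0` is `0`.
      rw [← hasSum_nat_add_iff' 1]
      simpa using h
    exact h'.tendsto_sum_nat
  have h3 := (h2.const_mul (μ.real {t | b ≤ (t : ℝ)})).mul_const (b ^ n)
  refine le_of_tendsto_of_tendsto' h3 h1 fun N => ?_
  simp only [Function.comp_apply, taylorCoeff_neg_log_one_sub_mul hb0 hb1, Complex.re_sum,
    ← Complex.ofReal_mul, Complex.ofReal_re]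
  rw [Finset.mul_sum, Finset.sum_mul]
  refine Finset.sum_le_sum fun k _ => ?_
  calc μ.real {t | b ≤ (t : ℝ)} * ((b ^ 2) ^ k / k) * b ^ n
      = μ.real {t | b ≤ (t : ℝ)} * b ^ (n + k) * (b ^ k / k) := by rw [pow_add]; ring
    _ ≤ moment μ (n + k) * (b ^ k / k) := by
        gcongr
        exact real_mul_pow_le_moment hb0.le (hint _)

/-- Along `(0, 1)` the function `Re g x - A / (1 - b x)` is a power series with nonnegative
coefficients, hence monotone, so its derivative at `b` is nonnegative. No termwise differentiation
is required. -/
theorem le_norm_deriv_of_coeff_ge {g : ℂ → ℂ} {c : ℕ → ℂ} {A b : ℝ} (hb0 : 0 < b) (hb1 : b < 1)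
    (hg : DifferentiableOn ℂ g (Metric.ball 0 1))
    (hs : ∀ z ∈ Metric.ball (0 : ℂ) 1, HasSum (fun n : ℕ => c n * z ^ n) (g z))
    (hc : ∀ n, A * b ^ n ≤ (c n).re) :
    A * (b / (1 - b ^ 2) ^ 2) ≤ ‖deriv g b‖ := by
  have hbb : ‖(b : ℂ)‖ < 1 := by rwa [Complex.norm_of_nonneg hb0.le]
  have hgd : HasDerivAt g (deriv g b) b :=
    (hg.differentiableAt (Metric.isOpen_ball.mem_nhds (mem_ball_zero_iff.2 hbb))).hasDerivAt
  have h1 : HasDerivAt (fun x : ℝ => (g x).re) (deriv g b).re b := hgd.real_of_complex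
  have hne : 1 - b * b ≠ 0 := by nlinarith
  have h2 : HasDerivAt (fun x : ℝ => A * (1 - b * x)⁻¹) (A * (b / (1 - b ^ 2) ^ 2)) b := by
    have := ((((hasDerivAt_id b).const_mul b).const_sub 1).inv hne).const_mul A
    convert! this using 2
    simp [sq]
  set φ : ℝ → ℝ := fun x => (g x).re - A * (1 - b * x)⁻¹
  have h3 : HasDerivAt φ ((deriv g b).re - A * (b / (1 - b ^ 2) ^ 2)) b := h1.sub h2
  have hsum : ∀ x ∈ Ioo (0 : ℝ) 1, HasSum (fun n => ((c n).re - A * b ^ n) * x ^ n) (φ x) := by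
    intro x hx
    have e1 := Complex.hasSum_re (hs x (by
      rw [mem_ball_zero_iff, Complex.norm_of_nonneg hx.1.le]; exact hx.2))
    have e2 := (hasSum_geometric_of_lt_one (mul_pos hb0 hx.1).le
      (by nlinarith [hx.1, hx.2] : b * x < 1)).mul_left A
    convert! e1.sub e2 using 2 with n
    rw [← Complex.ofReal_pow, Complex.re_mul_ofReal, mul_pow]
    ring
  have hmono : MonotoneOn φ (Ioo 0 1) := fun x hx y hy hxy =>
    hasSum_le (fun n => mul_le_mul_of_nonneg_left (pow_le_pow_left₀ hx.1.le hxy n)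
      (sub_nonneg.2 (hc n))) (hsum x hx) (hsum y hy)
  have hnn : 0 ≤ (deriv g b).re - A * (b / (1 - b ^ 2) ^ 2) := by
    have hnhds : Ioo (0 : ℝ) 1 ∈ 𝓝 b := Ioo_mem_nhds hb0 hb1
    have := hmono.derivWithin_nonneg (x := b)
    rwa [derivWithin_of_mem_nhds hnhds, h3.deriv] at this
  linarith [Complex.re_le_norm (deriv g b)]

/-! ### From boundedness to the logarithmic Carleson condition -/

theorem HankelBoundedOnBesov.isFiniteMeasure {p : ℝ} (hp : 1 < p) {μ : Measure (Ico (0 : ℝ) 1)}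
    (hμ : HankelBoundedOnBesov p μ) : IsFiniteMeasure μ := by
  obtain ⟨C, hC⟩ := hμ
  have h0 : MemBesov p (fun _ => 0) := by
    refine ⟨differentiableOn_const _, ?_⟩
    simp [besovNorm, rhoPow, Real.zero_rpow (by linarith : p ≠ 0),
      ENNReal.zero_rpow_of_pos (by positivity : 0 < p⁻¹)]
  obtain ⟨g, ⟨hint, -⟩, -⟩ := hC _ h0
  have h := hint 0
  simp only [pow_zero] at h
  exact (integrable_const_iff_isFiniteMeasure one_ne_zero).1 h

theorem rhoPow_le_besovNorm_rpow {p : ℝ} (hp : 1 < p) (g : ℂ → ℂ) :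
    rhoPow p g ≤ besovNorm p g ^ p := by
  rw [besovNorm, ← ENNReal.rpow_mul, one_div_mul_cancel (by linarith), ENNReal.rpow_one]
  exact le_add_self

theorem exists_tail_mul_log_rpow_le {p : ℝ} (hp : 1 < p) {μ : Measure (Ico (0 : ℝ) 1)}
    (hμ : HankelBoundedOnBesov p μ) :
    ∃ Q : ℝ, 0 ≤ Q ∧ ∀ h : ℝ, 0 < h → h ≤ 1 / 4 →
      (μ.real {t | 1 - h ≤ (t : ℝ)} * Real.log (1 / h) / (16 * h)) ^ p ≤
        Q * Real.log (1 / h) := by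
  have := hμ.isFiniteMeasure hp
  obtain ⟨C, hC⟩ := hμ
  obtain ⟨K, hK, hrho⟩ := exists_rhoPow_neg_log_le hp
  have hp0 : 0 < p := by linarith
  have hp1 : 0 < p - 1 := by linarith
  set k : ℝ := 6 ^ (-|p - 2|) / 4
  have hk : 0 < k := by positivity
  refine ⟨(C : ℝ) ^ p * (K * (1 / (p - 1) + 1)) / k, by positivity, fun h h0 h4 => ?_⟩
  set b : ℝ := 1 - h with hb
  set M := μ.real {t : Ico (0 : ℝ) 1 | b ≤ (t : ℝ)}
  set l := Real.log (1 / h) with hl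
  have hb0 : 0 < b := by linarith
  have hb1 : b < 1 := by linarith
  have hM : 0 ≤ M := measureReal_nonneg
  have hl2 : 2 * Real.log 2 ≤ l := by
    rw [show 2 * Real.log 2 = Real.log 4 by
      rw [show (4 : ℝ) = 2 ^ 2 by norm_num, Real.log_pow]; norm_num]
    exact Real.log_le_log (by norm_num) (by rw [le_div_iff₀ h0]; linarith)
  have hl1 : 1 ≤ l := by linarith [Real.log_two_gt_d9]
  set f : ℂ → ℂ := fun z => -Complex.log (1 - b * z)
  have hf : rhoPow p f ≤ ENNReal.ofReal (K * (1 / (p - 1) + l)) := hrho h h0 (by linarith)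
  have hfn : besovNorm p f = rhoPow p f ^ (1 / p) := besovNorm_neg_log_one_sub_mul hp b
  have hfm : MemBesov p f := by
    refine ⟨fun z hz => (hasDerivAt_neg_log_one_sub_mul hb0 hb1
      (mem_ball_zero_iff.1 hz)).differentiableAt.differentiableWithinAt, ?_⟩
    rw [hfn]
    exact ENNReal.rpow_lt_top_of_nonneg (by positivity) (hf.trans_lt ENNReal.ofReal_lt_top).ne
  obtain ⟨g, ⟨hint, c, hcn, hsum⟩, hgm, hgn⟩ := hC f hfm
  have hD := le_norm_deriv_of_coeff_ge hb0 hb1 hgm.1 hsum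
    fun n => re_coeff_ge hint hb0 hb1 (hcn n)
  have hbn : ‖(b : ℂ)‖ = b := Complex.norm_of_nonneg hb0.le
  have hup : k * (h * ‖deriv g b‖) ^ p ≤ (C : ℝ) ^ p * (K * (1 / (p - 1) + l)) := by
    have h1 := ofReal_mul_norm_deriv_rpow_le_rhoPow hp hgm.1 (a := b) (by rwa [hbn])
    rw [hbn, hb, sub_sub_cancel, ← hb] at h1
    refine (ENNReal.ofReal_le_ofReal_iff (by positivity)).1 ?_
    calc _ ≤ rhoPow p g := h1
      _ ≤ besovNorm p g ^ p := rhoPow_le_besovNorm_rpow hp g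
      _ ≤ (C * besovNorm p f) ^ p := ENNReal.rpow_le_rpow hgn hp0.le
      _ = (C : ℝ≥0∞) ^ p * rhoPow p f := by
        rw [ENNReal.mul_rpow_of_nonneg _ _ hp0.le, hfn, ← ENNReal.rpow_mul,
          one_div_mul_cancel hp0.ne', ENNReal.rpow_one]
      _ ≤ (C : ℝ≥0∞) ^ p * ENNReal.ofReal (K * (1 / (p - 1) + l)) := by gcongr
      _ = _ := by
        rw [ENNReal.ofReal_mul (p := (C : ℝ) ^ p) (by positivity),
          ← ENNReal.ofReal_rpow_of_nonneg C.coe_nonneg hp0.le,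
          ENNReal.ofReal_coe_nnreal]
  have hlow : M * l / (16 * h) ≤ h * ‖deriv g b‖ := by
    have hs0 : 0 < 1 - b ^ 2 := by nlinarith
    have hs1 : 1 - b ^ 2 ≤ 2 * h := by nlinarith
    -- From `1 - b² ≤ 2h` the right side is at least `l - log 2`, and `h ≤ 1/4` makes `log 2 ≤ l /
    -- 2`.
    have hL : l / 2 ≤ -Real.log (1 - b ^ 2) := by
      have := Real.log_le_log hs0 hs1
      rw [Real.log_mul (by norm_num) h0.ne'] at this
      rw [one_div, Real.log_inv] at hl
      linarith
    -- Here `b ≥ 3/4` and `(1 - b²)² ≤ 4 h²`.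
    have hq : 3 / (16 * h ^ 2) ≤ b / (1 - b ^ 2) ^ 2 := by
      rw [div_le_div_iff₀ (by positivity) (by positivity)]
      have : (1 - b ^ 2) ^ 2 ≤ (2 * h) ^ 2 := pow_le_pow_left₀ hs0.le hs1 2
      nlinarith
    calc M * l / (16 * h) ≤ h * (M * (l / 2) * (3 / (16 * h ^ 2))) := by
          rw [show h * (M * (l / 2) * (3 / (16 * h ^ 2))) = 3 / 2 * (M * l / (16 * h)) by
            field_simp]
          have : 0 ≤ M * l / (16 * h) := by positivity
          linarith
      _ ≤ h * (M * -Real.log (1 - b ^ 2) * (b / (1 - b ^ 2) ^ 2)) := by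
          have : 0 ≤ M * -Real.log (1 - b ^ 2) := mul_nonneg hM (by linarith)
          gcongr
      _ ≤ _ := by gcongr
  rw [div_mul_eq_mul_div, le_div_iff₀ hk]
  calc (M * l / (16 * h)) ^ p * k ≤ (h * ‖deriv g b‖) ^ p * k := by gcongr
    _ ≤ (C : ℝ) ^ p * (K * (1 / (p - 1) + l)) := by linarith
    _ ≤ (C : ℝ) ^ p * (K * ((1 / (p - 1) + 1) * l)) := by
        gcongr
        have : 1 / (p - 1) * 1 ≤ 1 / (p - 1) * l := by gcongr
        linarith
    _ = _ := by ring

theorem exists_tail_mul_log_rpow_le_mul {p : ℝ} (hp : 1 < p) {μ : Measure (Ico (0 : ℝ) 1)}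
    (hμ : HankelBoundedOnBesov p μ) {γ : ℝ} (hγ₀ : 0 ≤ γ) (hγ : γ ≤ 1 - 1 / p) :
    ∃ K : ℝ, 0 ≤ K ∧ ∀ h : ℝ, 0 < h → h ≤ 1 →
      μ.real {t | 1 - h ≤ (t : ℝ)} * Real.log (1 / h) ^ γ ≤ K * h := by
  have := hμ.isFiniteMeasure hp
  have hp0 : 0 < p := by linarith
  obtain ⟨Q, hQ, hQb⟩ := exists_tail_mul_log_rpow_le hp hμ
  have hlog4 : 0 < Real.log 4 := Real.log_pos (by norm_num)
  refine ⟨max (16 * Q ^ (1 / p)) (4 * (μ.real univ * Real.log 4 ^ γ)),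
    le_max_of_le_left (by positivity), fun h h0 h1 => ?_⟩
  set M := μ.real {t : Ico (0 : ℝ) 1 | 1 - h ≤ (t : ℝ)}
  set l := Real.log (1 / h)
  have hM : 0 ≤ M := measureReal_nonneg
  -- For small `h`, take `p`-th roots and divide by `l^(1/p)`; `l ≥ 1` allows any exponent up to `1
  -- - 1/p`. For `h > 1/4`, finiteness of `μ` and `l ≤ log 4` suffice.
  rcases le_or_gt h (1 / 4) with h4 | h4
  · have hl1 : 1 ≤ l := by
      have h2 : Real.log 4 ≤ l :=
        Real.log_le_log (by norm_num) (by rw [le_div_iff₀ h0]; linarith)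
      rw [show (4 : ℝ) = 2 ^ 2 by norm_num, Real.log_pow] at h2
      push_cast at h2
      linarith [Real.log_two_gt_d9]
    have hl0 : 0 < l := by linarith
    have h2 : M * l / (16 * h) ≤ Q ^ (1 / p) * l ^ (1 / p) := by
      rw [← Real.mul_rpow hQ hl0.le, one_div]
      exact (Real.le_rpow_inv_iff_of_pos (by positivity) (by positivity) hp0).2 (hQb h h0 h4)
    rw [div_le_iff₀ (by positivity)] at h2
    calc M * l ^ γ ≤ M * l ^ (1 - 1 / p) := by gcongr
      _ = M * l / l ^ (1 / p) := by rw [Real.rpow_sub hl0, Real.rpow_one, mul_div_assoc]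
      _ ≤ 16 * Q ^ (1 / p) * h := by
        rw [div_le_iff₀ (by positivity)]; linarith
      _ ≤ _ := by gcongr; exact le_max_left _ _
  · have hl0 : 0 ≤ l := Real.log_nonneg (by rw [le_div_iff₀ h0]; linarith)
    have hl4 : l ≤ Real.log 4 :=
      Real.log_le_log (by positivity) (by rw [div_le_iff₀ h0]; linarith)
    have hX : 0 ≤ μ.real univ * Real.log 4 ^ γ := by positivity
    calc M * l ^ γ ≤ μ.real univ * Real.log 4 ^ γ := by
          gcongr
          exact measureReal_mono (subset_univ _)
      _ ≤ 4 * (μ.real univ * Real.log 4 ^ γ) * h := by nlinarith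
      _ ≤ _ := by gcongr; exact le_max_right _ _

/-- Enlarging the square to the set `|z| ≥ 1 - |J|/2π` removes the dependence on the position of the
arc and gives a measurable set, so the pushforward can be evaluated. -/
theorem toDisc_carlesonSquare_le (μ : Measure (Ico (0 : ℝ) 1)) (J : Set ℝ) :
    toDisc μ (carlesonSquare J) ≤
      μ {t | 1 - volume.real J / (2 * Real.pi) ≤ (t : ℝ)} := by
  have hs : MeasurableSet {z : ℂ | 1 - volume.real J / (2 * Real.pi) ≤ ‖z‖} :=
    measurableSet_le measurable_const measurable_norm
  calc toDisc μ (carlesonSquare J)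
      ≤ toDisc μ {z : ℂ | 1 - volume.real J / (2 * Real.pi) ≤ ‖z‖} := by
        refine measure_mono ?_
        rintro z ⟨r, θ, -, hr, hr0, -, rfl⟩
        simpa [Complex.norm_exp_ofReal_mul_I, abs_of_nonneg hr0] using hr
    _ = _ := by
        have hm : Measurable fun t : Ico (0 : ℝ) 1 => ((t : ℝ) : ℂ) :=
          Complex.measurable_ofReal.comp measurable_subtype_coe
        rw [toDisc, Measure.map_apply hm hs]
        congr 1
        ext t
        simp only [mem_preimage, mem_ofPred_eq, Complex.norm_of_nonneg t.2.1]

end BesovHankel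

theorem mainTheorem6 (p : ℝ) (hp : 1 < p)
    (μ : MeasureTheory.Measure (Set.Ico (0 : ℝ) 1))
    (hμ : BesovHankel.HankelBoundedOnBesov p μ)
    (γ : ℝ) (hγ₀ : 0 ≤ γ) (hγ : γ < 1 - 1 / p) :
    BesovHankel.IsLogCarleson γ 1 (BesovHankel.toDisc μ) := by
  have := hμ.isFiniteMeasure hp
  obtain ⟨K, hK, hb⟩ := BesovHankel.exists_tail_mul_log_rpow_le_mul hp hμ hγ₀ hγ.le
  refine ⟨K.toNNReal, fun J _ hJ0 hJ => ?_⟩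
  have hpi := Real.pi_gt_three
  have hJt : volume J ≠ ∞ := (hJ.trans_lt ENNReal.ofReal_lt_top).ne
  have hv0 : 0 < volume.real J := ENNReal.toReal_pos hJ0.ne' hJt
  have hv1 : volume.real J ≤ 2 * Real.pi := ENNReal.toReal_le_of_le_ofReal (by positivity) hJ
  have h := hb (volume.real J / (2 * Real.pi)) (by positivity)
    ((div_le_one (by positivity)).2 hv1)
  rw [one_div_div] at h
  calc _ ≤ μ {t | 1 - volume.real J / (2 * Real.pi) ≤ (t : ℝ)} *
        ENNReal.ofReal (Real.log (2 * Real.pi / volume.real J) ^ γ) := by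
        gcongr
        exact BesovHankel.toDisc_carlesonSquare_le μ J
    _ = ENNReal.ofReal (μ.real {t | 1 - volume.real J / (2 * Real.pi) ≤ (t : ℝ)} *
        Real.log (2 * Real.pi / volume.real J) ^ γ) := by
        rw [ENNReal.ofReal_mul measureReal_nonneg, ofReal_measureReal]
    _ ≤ ENNReal.ofReal (K * volume.real J) := by
        refine ENNReal.ofReal_le_ofReal (h.trans ?_)
        gcongr
        exact div_le_self hv0.le (by linarith)
    _ = _ := by rw [ENNReal.ofReal_mul hK, Real.rpow_one]; rfl
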